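/- Let $\mathbb D=\{z\in\mathbb C:|z|<1\}$ and let $H^2$ be the Hardy space of holomorphic functions $f$ on $\mathbb D$ whose square means $\frac1{2\pi}\int_0^{2\pi}|f(re^{i\theta})|^2\,d\theta$ are bounded for $0\le r<1$, with its usual Hilbert space structure $\langle f,g\rangle=\lim_{r\to1^-}\frac1{2\pi}\int_0^{2\pi}f(re^{i\theta})\overline{g(re^{i\theta})}\,d\theta$. Let $\psi_0,\psi_1:\mathbb D\to\mathbb C$ be holomorphic. The maximal operator $\mathcal E_{\max}$ is defined by $\operatorname{dom}(\mathcal E_{\max})=\{f\in H^2:\psi_0f+\psi_1f'\in H^2\}$ and $\mathcal E_{\max}f=\psi_0f+\psi_1f'$. Let $\mathcal E$ be a first-order differential operator induced by $\psi_0,\psi_1$, that is, a linear operator in $H^2$, defined on a linear subspace $\operatorname{dom}(\mathcal E)\subseteq\operatorname{dom}(\mathcal E_{\max})$, with $\mathcal Ef=\mathcal E_{\max}f$ for every $f\in\operatorname{dom}(\mathcal E)$ (written $\mathcal E\preceq\mathcal E_{\max}$). Let $\beta,\lambda\in\mathbb C$ with $|\beta|=1$ and $0<|\lambda|<1$, and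 let $\mathcal J_{\beta,\lambda}$ be the conjugation on $H^2$ given by $$\mathcal J_{\beta,\lambda}f(z)=\beta\,\frac{\sqrt{1-|\lambda|^2}}{1-z\overline\lambda}\;\overline{f\bigl(\overline{\varphi(z)}\bigr)},\qquad \varphi(z)=\frac{\overline\lambda}{\lambda}\cdot\frac{\lambda-z}{1-z\overline\lambda},\qquad z\in\mathbb D.$$ The operator $\mathcal E$ is called $\mathcal J_{\beta,\lambda}$-selfadjoint if it is densely defined and $\mathcal E=\mathcal J_{\beta,\lambda}\mathcal E^*\mathcal J_{\beta,\lambda}$ (equality of unbounded operators, including domains). **Theorem.** The operator $\mathcal E$ is $\mathcal J_{\beta,\lambda}$-selfadjoint if and only if both of the following conditions hold. 1. $\mathcal E=\mathcal E_{\max}$. 2. There are $a,b,c,d\in\mathbb C$ with $d=-\lambda b\,\overline{\lambda}^{-1}-\lambda c$ such that $\psi_0(u)=a+bu$ and $\psi_1(u)=d+cu+bu^2$ for all $u\in\mathbb D$. -/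

import Mathlib

namespace HardyDiff

open ComplexConjugate Complex Metric Real Set Filter Topology

theorem circleAverage_monomial (r : ℝ) (m n : ℕ) :
    circleAverage (fun z : ℂ => conj z ^ m * z ^ n) 0 r = if m = n then (r : ℂ) ^ (2 * n) else 0 := by
  have hz : ∀ θ : ℝ, conj (circleMap 0 r θ) ^ m * circleMap 0 r θ ^ n
      = (r : ℂ) ^ (m + n) * cexp ((((n : ℂ) - m) * I) * θ) := by
    intro θ
    simp only [circleMap, zero_add, map_mul, conj_ofReal, ← Complex.exp_conj, conj_I, mul_pow,
      ← Complex.exp_nat_mul]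
    rw [show (r : ℂ) ^ m * cexp (m * (θ * -I)) * (r ^ n * cexp (n * (θ * I)))
      = r ^ (m + n) * (cexp (m * (θ * -I)) * cexp (n * (θ * I))) by ring, ← Complex.exp_add]
    congr 2
    ring
  simp only [circleAverage, hz]
  split_ifs with h
  · subst h
    simp [← two_mul, mul_comm]
    field_simp
  · have hc : ((n : ℂ) - m) * I ≠ 0 := by
      refine mul_ne_zero (sub_ne_zero.mpr ?_) I_ne_zero
      simpa [eq_comm] using h
    have : cexp (((n : ℂ) - m) * I * (2 * π)) = 1 := by
      rw [Complex.exp_eq_one_iff]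
      exact ⟨(n : ℤ) - m, by push_cast; ring⟩
    rw [intervalIntegral.integral_const_mul, integral_exp_mul_complex hc]
    simp [this]

theorem hasSum_circleAverage {f g : ℂ → ℂ} {a b : ℕ → ℂ} {r : ℝ} (hr : 0 ≤ r)
    (ha : Summable fun n => ‖a n‖ * r ^ n) (hb : Summable fun n => ‖b n‖ * r ^ n)
    (hf : ∀ z, ‖z‖ = r → HasSum (fun n => a n * z ^ n) (f z))
    (hg : ∀ z, ‖z‖ = r → HasSum (fun n => b n * z ^ n) (g z)) :
    HasSum (fun n => conj (a n) * b n * (r : ℂ) ^ (2 * n))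
      (circleAverage (fun z => conj (f z) * g z) 0 r) := by
  set F : ℕ × ℕ → ℂ → ℂ := fun p z => conj (a p.1) * b p.2 * (conj z ^ p.1 * z ^ p.2) with hF
  have hFn : ∀ p z, ‖z‖ = r → ‖F p z‖ = (‖a p.1‖ * r ^ p.1) * (‖b p.2‖ * r ^ p.2) := by
    intro p z hz
    simp only [hF, norm_mul, RCLike.norm_conj, norm_pow, hz]
    ring
  have hS : Summable fun p : ℕ × ℕ => (‖a p.1‖ * r ^ p.1) * (‖b p.2‖ * r ^ p.2) :=
    ha.mul_of_nonneg hb (fun n => by positivity) (fun n => by positivity)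
  have hcm : ∀ θ, ‖circleMap 0 r θ‖ = r := fun θ => by simp [abs_of_nonneg hr]
  have hpt : ∀ z, ‖z‖ = r → HasSum (fun p => F p z) (conj (f z) * g z) := by
    intro z hz
    have h1 : HasSum (fun n => conj (a n) * conj z ^ n) (conj (f z)) := by
      have := Complex.hasSum_conj'.mpr (hf z hz)
      simpa using this
    have h2 : Summable fun p : ℕ × ℕ => (conj (a p.1) * conj z ^ p.1) * (b p.2 * z ^ p.2) := by
      refine Summable.of_norm (hS.congr fun p => ?_)
      rw [← hFn p z hz]
      congr 1
      simp only [hF]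
      ring
    have h3 := h1.mul (hg z hz) h2
    have h4 : (fun p => F p z) = fun p : ℕ × ℕ => (conj (a p.1) * conj z ^ p.1) * (b p.2 * z ^ p.2) := by
      funext p
      simp only [hF]
      ring
    rw [h4]
    exact h3
  have hI := intervalIntegral.hasSum_integral_of_dominated_convergence (μ := MeasureTheory.volume)
    (a := 0) (b := 2 * π) (F := fun p θ => F p (circleMap 0 r θ))
    (f := fun θ => conj (f (circleMap 0 r θ)) * g (circleMap 0 r θ))
    (fun p _ => (‖a p.1‖ * r ^ p.1) * (‖b p.2‖ * r ^ p.2))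
    (fun p => Continuous.aestronglyMeasurable (by simp only [hF]; fun_prop))
    (fun p => .of_forall fun θ _ => (hFn p _ (hcm θ)).le)
    (.of_forall fun _ _ => hS) (by simp) (.of_forall fun θ _ => hpt _ (hcm θ))
  have hA := hI.const_smul ((2 * π)⁻¹ : ℝ)
  change HasSum (fun p => circleAverage (F p) 0 r)
    (circleAverage (fun z => conj (f z) * g z) 0 r) at hA
  have hav : ∀ p : ℕ × ℕ, circleAverage (F p) 0 r
      = conj (a p.1) * b p.2 * if p.1 = p.2 then (r : ℂ) ^ (2 * p.2) else 0 := by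
    intro p
    rw [← circleAverage_monomial r p.1 p.2, ← smul_eq_mul, ← circleAverage_fun_smul]
    rfl
  simp only [hav] at hA
  have hinj : Function.Injective fun n : ℕ => (n, n) := fun m n h => (Prod.ext_iff.mp h).1
  rw [← hinj.hasSum_iff] at hA
  · simpa [Function.comp_def] using hA
  · rintro ⟨m, n⟩ h
    have : m ≠ n := fun h' => h ⟨m, by simp [h']⟩
    simp [this]

/-- `f` belongs to `H²`: it is holomorphic in the open unit disc, and its square means over the
circles of radius `r < 1` are bounded. Only the values of `f` in the disc matter. -/
def IsHardy (f : ℂ → ℂ) : Prop :=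
  DifferentiableOn ℂ f (ball 0 1) ∧
    ∃ C : ℝ, ∀ r ∈ Ico (0 : ℝ) 1, circleAverage (fun z => ‖f z‖ ^ 2) 0 r ≤ C

/-- The Taylor coefficients of `f` at the origin. -/
noncomputable def taylorCoeff (f : ℂ → ℂ) (n : ℕ) : ℂ := (n.factorial : ℂ)⁻¹ * iteratedDeriv n f 0

/-- `f` is the sum of the power series with coefficients `a` in the unit disc. -/
def HasCoeffs (f : ℂ → ℂ) (a : ℕ → ℂ) : Prop :=
  ∀ z : ℂ, ‖z‖ < 1 → HasSum (fun n => a n * z ^ n) (f z)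

theorem hasCoeffs_taylorCoeff {f : ℂ → ℂ} (hf : DifferentiableOn ℂ f (ball 0 1)) :
    HasCoeffs f (taylorCoeff f) := by
  intro z hz
  have := Complex.hasSum_taylorSeries_on_ball hf (z := z) (by simpa using hz)
  refine this.congr_fun fun n => ?_
  simp [taylorCoeff]
  ring

theorem HasCoeffs.summable {f : ℂ → ℂ} {a : ℕ → ℂ} (h : HasCoeffs f a) {r : ℝ}
    (hr : r ∈ Ico (0 : ℝ) 1) : Summable fun n => ‖a n‖ * r ^ n := by
  have h1 := (h (r : ℂ) (by simpa [abs_of_nonneg hr.1] using hr.2)).summable.norm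
  simpa [abs_of_nonneg hr.1] using h1

theorem HasCoeffs.hasSum_mean {f g : ℂ → ℂ} {a b : ℕ → ℂ} (hf : HasCoeffs f a)
    (hg : HasCoeffs g b) {r : ℝ} (hr : r ∈ Ico (0 : ℝ) 1) :
    HasSum (fun n => conj (a n) * b n * (r : ℂ) ^ (2 * n))
      (circleAverage (fun z => conj (f z) * g z) 0 r) :=
  hasSum_circleAverage hr.1 (hf.summable hr) (hg.summable hr)
    (fun z hz => hf z (hz ▸ hr.2)) (fun z hz => hg z (hz ▸ hr.2))

theorem HasCoeffs.hasSum_sq_mean {f : ℂ → ℂ} {a : ℕ → ℂ} (hf : HasCoeffs f a) {r : ℝ}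
    (hr : r ∈ Ico (0 : ℝ) 1) :
    HasSum (fun n => ‖a n‖ ^ 2 * r ^ (2 * n)) (circleAverage (fun z => ‖f z‖ ^ 2) 0 r) := by
  have h1 := hf.hasSum_mean hf hr
  have h2 : circleAverage (fun z => conj (f z) * f z) 0 r
      = ((circleAverage (fun z => ‖f z‖ ^ 2) 0 r : ℝ) : ℂ) := by
    simp only [circleAverage, RCLike.conj_mul, smul_eq_mul]
    push_cast
    rw [← intervalIntegral.integral_ofReal]
    simp
  rw [h2] at h1
  rw [← Complex.hasSum_ofReal]
  refine h1.congr_fun fun n => ?_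
  simp [RCLike.conj_mul]

theorem HasCoeffs.differentiableOn {f : ℂ → ℂ} {a : ℕ → ℂ} (hf : HasCoeffs f a) :
    DifferentiableOn ℂ f (ball 0 1) := by
  intro z hz
  rw [mem_ball_zero_iff] at hz
  obtain ⟨r, hzr, hr⟩ := exists_between hz
  have hr0 : 0 ≤ r := (norm_nonneg z).trans hzr.le
  have h1 : DifferentiableOn ℂ (fun w => ∑' n, a n * w ^ n) (ball 0 r) := by
    refine differentiableOn_tsum_of_summable_norm (hf.summable ⟨hr0, hr⟩)
      (fun n => by fun_prop) isOpen_ball fun n w hw => ?_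
    rw [mem_ball_zero_iff] at hw
    rw [norm_mul, norm_pow]
    gcongr
  have h2 : (fun w => ∑' n, a n * w ^ n) =ᶠ[𝓝 z] f := by
    filter_upwards [isOpen_ball.mem_nhds (show z ∈ ball (0 : ℂ) 1 by simpa using hz)] with w hw
    exact (hf w (by simpa using hw)).tsum_eq
  exact ((h1.differentiableAt (isOpen_ball.mem_nhds (by simpa using hzr))).congr_of_eventuallyEq
    h2.symm).differentiableWithinAt

theorem HasCoeffs.isHardy {f : ℂ → ℂ} {a : ℕ → ℂ} (hf : HasCoeffs f a)
    (ha : Summable fun n => ‖a n‖ ^ 2) : IsHardy f := by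
  refine ⟨hf.differentiableOn, ∑' n, ‖a n‖ ^ 2, fun r hr => ?_⟩
  rw [← (hf.hasSum_sq_mean hr).tsum_eq]
  refine (hf.hasSum_sq_mean hr).summable.tsum_le_tsum (fun n => ?_) ha
  exact mul_le_of_le_one_right (by positivity) (pow_le_one₀ hr.1 hr.2.le)

theorem IsHardy.summable_sq {f : ℂ → ℂ} {a : ℕ → ℂ} (h : IsHardy f) (hf : HasCoeffs f a) :
    Summable fun n => ‖a n‖ ^ 2 := by
  obtain ⟨-, C, hC⟩ := h
  refine summable_of_sum_range_le (c := C) (fun n => by positivity) fun N => ?_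
  have hcont : Tendsto (fun r : ℝ => ∑ n ∈ Finset.range N, ‖a n‖ ^ 2 * r ^ (2 * n)) (𝓝[<] 1)
      (𝓝 (∑ n ∈ Finset.range N, ‖a n‖ ^ 2 * (1 : ℝ) ^ (2 * n))) :=
    ((by fun_prop : Continuous fun r : ℝ => ∑ n ∈ Finset.range N, ‖a n‖ ^ 2 * r ^ (2 * n)).tendsto
      1).mono_left nhdsWithin_le_nhds
  have := le_of_tendsto hcont (b := C) (by
    filter_upwards [Ico_mem_nhdsLT (zero_lt_one (α := ℝ))] with r hr
    refine le_trans ?_ (hC r hr)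
    have hr0 := hr.1
    exact sum_le_hasSum _ (fun n _ => by positivity) (hf.hasSum_sq_mean hr))
  simpa using this

theorem summable_conj_mul {a b : ℕ → ℂ} (ha : Summable fun n => ‖a n‖ ^ 2)
    (hb : Summable fun n => ‖b n‖ ^ 2) : Summable fun n => ‖conj (a n) * b n‖ := by
  refine Summable.of_nonneg_of_le (fun n => norm_nonneg _) (fun n => ?_) (ha.add hb)
  rw [norm_mul, RCLike.norm_conj]
  nlinarith [sq_nonneg (‖a n‖ - ‖b n‖), sq_nonneg ‖a n‖, sq_nonneg ‖b n‖]

theorem HasCoeffs.tendsto_mean {f g : ℂ → ℂ} {a b : ℕ → ℂ} (hf : HasCoeffs f a)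
    (hg : HasCoeffs g b) (ha : Summable fun n => ‖a n‖ ^ 2) (hb : Summable fun n => ‖b n‖ ^ 2) :
    Tendsto (fun r : ℝ => circleAverage (fun z => conj (f z) * g z) 0 r) (𝓝[<] 1)
      (𝓝 (∑' n, conj (a n) * b n)) := by
  have h1 : Tendsto (fun r : ℝ => ∑' n, conj (a n) * b n * (r : ℂ) ^ (2 * n)) (𝓝[<] 1)
      (𝓝 (∑' n, conj (a n) * b n)) := by
    refine tendsto_tsum_of_dominated_convergence (summable_conj_mul ha hb) (fun n => ?_) ?_
    · have : Continuous fun r : ℝ => conj (a n) * b n * (r : ℂ) ^ (2 * n) := by fun_prop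
      simpa using (this.tendsto 1).mono_left nhdsWithin_le_nhds
    · filter_upwards [Ico_mem_nhdsLT (zero_lt_one (α := ℝ))] with r hr n
      rw [norm_mul _ ((r : ℂ) ^ _), norm_pow, Complex.norm_real, Real.norm_of_nonneg hr.1]
      exact mul_le_of_le_one_right (norm_nonneg _) (pow_le_one₀ hr.1 hr.2.le)
  refine h1.congr' ?_
  filter_upwards [Ico_mem_nhdsLT (zero_lt_one (α := ℝ))] with r hr
  exact (hf.hasSum_mean hg hr).tsum_eq

theorem IsHardy.congr {f g : ℂ → ℂ} (hf : IsHardy f) (h : EqOn f g (ball 0 1)) : IsHardy g := by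
  refine ⟨hf.1.congr fun z hz => (h hz).symm, ?_⟩
  obtain ⟨C, hC⟩ := hf.2
  refine ⟨C, fun r hr => ?_⟩
  rw [← circleAverage_congr_sphere (f₁ := fun z => ‖f z‖ ^ 2)]
  · exact hC r hr
  · intro z hz
    rw [mem_sphere_zero_iff_norm, abs_of_nonneg hr.1] at hz
    simp only
    rw [h (by rw [mem_ball_zero_iff, hz]; exact hr.2)]

theorem IsHardy.add {f g : ℂ → ℂ} (hf : IsHardy f) (hg : IsHardy g) :
    IsHardy fun z => f z + g z := by
  have h1 := hasCoeffs_taylorCoeff hf.1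
  have h2 := hasCoeffs_taylorCoeff hg.1
  refine HasCoeffs.isHardy (a := fun n => taylorCoeff f n + taylorCoeff g n) (fun z hz => ?_) ?_
  · simpa [add_mul] using (h1 z hz).add (h2 z hz)
  · refine Summable.of_nonneg_of_le (fun n => by positivity) (fun n => ?_)
      (((hf.summable_sq h1).add (hg.summable_sq h2)).mul_left 2)
    have := norm_add_le (taylorCoeff f n) (taylorCoeff g n)
    have h0 := norm_nonneg (taylorCoeff f n + taylorCoeff g n)
    nlinarith [sq_nonneg (‖taylorCoeff f n‖ - ‖taylorCoeff g n‖)]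

theorem IsHardy.const_mul {f : ℂ → ℂ} (c : ℂ) (hf : IsHardy f) : IsHardy fun z => c * f z := by
  have h1 := hasCoeffs_taylorCoeff hf.1
  refine HasCoeffs.isHardy (a := fun n => c * taylorCoeff f n) (fun z hz => ?_) ?_
  · simpa [mul_assoc] using (h1 z hz).mul_left c
  · simpa [mul_pow] using (hf.summable_sq h1).mul_left (‖c‖ ^ 2)

theorem isHardy_zero : IsHardy fun _ => 0 :=
  HasCoeffs.isHardy (a := fun _ => 0) (fun z _ => by simp) (by simp)

/-- The functions on the unit disc that belong to `H²`, each one extended by zero to a function on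
`ℂ`, so that equality in this space is equality on the disc. -/
def hardySubmodule : Submodule ℂ (ℂ → ℂ) where
  carrier := {f | IsHardy f ∧ ∀ z, 1 ≤ ‖z‖ → f z = 0}
  add_mem' := fun hf hg => ⟨hf.1.add hg.1, fun z hz => by simp [hf.2 z hz, hg.2 z hz]⟩
  zero_mem' := ⟨isHardy_zero, fun _ _ => rfl⟩
  smul_mem' := fun c f hf => ⟨hf.1.const_mul c, fun z hz => by simp [hf.2 z hz]⟩

/-- The Hardy space `H²` of the unit disc. -/
def Hardy : Type := hardySubmodule

namespace Hardy

noncomputable instance : AddCommGroup Hardy := inferInstanceAs (AddCommGroup hardySubmodule)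

noncomputable instance : Module ℂ Hardy := inferInstanceAs (Module ℂ hardySubmodule)

instance : CoeFun Hardy fun _ => ℂ → ℂ := ⟨fun f => f.1⟩

theorem isHardy (f : Hardy) : IsHardy f := f.2.1

theorem ext {f g : Hardy} (h : ∀ z : ℂ, ‖z‖ < 1 → f z = g z) : f = g := by
  refine Subtype.ext (funext fun z => ?_)
  rcases lt_or_ge ‖z‖ 1 with hz | hz
  · exact h z hz
  · exact (f.2.2 z hz).trans (g.2.2 z hz).symm

@[simp] theorem add_apply (f g : Hardy) (z : ℂ) : (f + g) z = f z + g z := rfl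

@[simp] theorem smul_apply (c : ℂ) (f : Hardy) (z : ℂ) : (c • f) z = c * f z := rfl

@[simp] theorem zero_apply (z : ℂ) : (0 : Hardy) z = 0 := rfl

/-- The element of `H²` given in the disc by the formula `F`. -/
noncomputable def mk (F : ℂ → ℂ) (hF : IsHardy F) : Hardy :=
  ⟨(ball (0 : ℂ) 1).indicator F,
    hF.congr fun _ hz => (indicator_of_mem hz F).symm,
    fun z hz => indicator_of_notMem (by simpa using hz) F⟩

theorem mk_apply {F : ℂ → ℂ} (hF : IsHardy F) {z : ℂ} (hz : ‖z‖ < 1) : mk F hF z = F z :=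
  indicator_of_mem (by simpa using hz) F

theorem differentiableAt (f : Hardy) {z : ℂ} (hz : ‖z‖ < 1) : DifferentiableAt ℂ f z :=
  f.isHardy.1.differentiableAt (isOpen_ball.mem_nhds (by simpa using hz))

theorem hasCoeffs (f : Hardy) : HasCoeffs f (taylorCoeff f) := hasCoeffs_taylorCoeff f.isHardy.1

theorem summable_sq (f : Hardy) : Summable fun n => ‖taylorCoeff f n‖ ^ 2 :=
  f.isHardy.summable_sq f.hasCoeffs

/-- The inner product of `H²`, conjugate-linear in the first variable: the limit, as `r → 1⁻`, of
the mean of `conj f * g` over the circle of radius `r`. -/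
noncomputable def innerProd (f g : Hardy) : ℂ :=
  limUnder (𝓝[<] (1 : ℝ)) fun r => circleAverage (fun z => conj (f z) * g z) 0 r

theorem innerProd_eq_tsum_of_hasCoeffs {f g : Hardy} {a b : ℕ → ℂ} (ha : HasCoeffs f a)
    (hb : HasCoeffs g b) : innerProd f g = ∑' n, conj (a n) * b n :=
  (ha.tendsto_mean hb (f.isHardy.summable_sq ha) (g.isHardy.summable_sq hb)).limUnder_eq

theorem innerProd_eq_tsum (f g : Hardy) :
    innerProd f g = ∑' n, conj (taylorCoeff f n) * taylorCoeff g n :=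
  innerProd_eq_tsum_of_hasCoeffs f.hasCoeffs g.hasCoeffs

@[reducible]
noncomputable def core : InnerProductSpace.Core ℂ Hardy where
  inner := innerProd
  conj_inner_symm f g := by
    simp only [innerProd_eq_tsum, Complex.conj_tsum, map_mul, Complex.conj_conj]
    exact tsum_congr fun n => mul_comm _ _
  re_inner_nonneg f := by
    rw [innerProd_eq_tsum, RCLike.re_to_complex, Complex.re_tsum
      (summable_conj_mul f.summable_sq f.summable_sq).of_norm]
    refine tsum_nonneg fun n => ?_
    rw [RCLike.conj_mul]
    simp [← Complex.ofReal_pow]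
  add_left f g h := by
    have hfg : HasCoeffs (f + g : Hardy) fun n => taylorCoeff f n + taylorCoeff g n := by
      intro z hz
      simpa [add_mul] using (f.hasCoeffs z hz).add (g.hasCoeffs z hz)
    rw [innerProd_eq_tsum_of_hasCoeffs hfg h.hasCoeffs, innerProd_eq_tsum, innerProd_eq_tsum,
      ← (summable_conj_mul f.summable_sq h.summable_sq).of_norm.tsum_add
        (summable_conj_mul g.summable_sq h.summable_sq).of_norm]
    exact tsum_congr fun n => by simp [add_mul]
  smul_left f g c := by
    have hcf : HasCoeffs (c • f : Hardy) fun n => c * taylorCoeff f n := by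
      intro z hz
      simpa [mul_assoc] using (f.hasCoeffs z hz).mul_left c
    rw [innerProd_eq_tsum_of_hasCoeffs hcf g.hasCoeffs, innerProd_eq_tsum, ← tsum_mul_left]
    exact tsum_congr fun n => by simp [mul_assoc]
  definite f hf := by
    have h1 : ((∑' n, ‖taylorCoeff f n‖ ^ 2 : ℝ) : ℂ) = 0 := by
      rw [← hf, innerProd_eq_tsum, Complex.ofReal_tsum]
      exact tsum_congr fun n => by simp [RCLike.conj_mul]
    have h2 : HasSum (fun n => ‖taylorCoeff f n‖ ^ 2) 0 := by
      rw [← Complex.ofReal_eq_zero.mp h1]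
      exact f.summable_sq.hasSum
    rw [hasSum_zero_iff_of_nonneg fun n => sq_nonneg _] at h2
    refine Hardy.ext fun z hz => (f.hasCoeffs z hz).unique ?_
    have h3 : ∀ n, taylorCoeff f n = 0 := fun n => by simpa using congrFun h2 n
    simp [h3]

noncomputable instance : NormedAddCommGroup Hardy :=
  @InnerProductSpace.Core.toNormedAddCommGroup ℂ Hardy _ _ _ core

noncomputable instance : InnerProductSpace ℂ Hardy := InnerProductSpace.ofCore core.toCore

theorem inner_eq_tsum_of_hasCoeffs {f g : Hardy} {a b : ℕ → ℂ} (ha : HasCoeffs f a)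
    (hb : HasCoeffs g b) : inner ℂ f g = ∑' n, conj (a n) * b n :=
  innerProd_eq_tsum_of_hasCoeffs ha hb

/-- The limit that defines the inner product exists. -/
theorem tendsto_inner (f g : Hardy) :
    Tendsto (fun r : ℝ => circleAverage (fun z => conj (f z) * g z) 0 r) (𝓝[<] 1)
      (𝓝 (inner ℂ f g)) := by
  rw [inner_eq_tsum_of_hasCoeffs f.hasCoeffs g.hasCoeffs]
  exact f.hasCoeffs.tendsto_mean g.hasCoeffs f.summable_sq g.summable_sq

theorem hasCoeffs_tsum (a : lp (fun _ : ℕ => ℂ) 2) :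
    HasCoeffs (fun z => ∑' n, a n * z ^ n) a := by
  intro z hz
  refine Summable.hasSum (Summable.of_norm ?_)
  refine Summable.of_nonneg_of_le (fun n => norm_nonneg _) (fun n => ?_)
    ((summable_geometric_of_lt_one (norm_nonneg z) hz).mul_left ‖a‖)
  rw [norm_mul, norm_pow]
  gcongr
  exact lp.norm_apply_le_norm two_ne_zero a n

theorem summable_sq_lp (a : lp (fun _ : ℕ => ℂ) 2) : Summable fun n => ‖a n‖ ^ 2 := by
  simpa using (lp.memℓp a).summable (by norm_num)

/-- The element of `H²` with given square-summable Taylor coefficients. -/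
noncomputable def ofCoeffs : lp (fun _ : ℕ => ℂ) 2 →ₗ[ℂ] Hardy where
  toFun a := mk (fun z => ∑' n, a n * z ^ n) ((hasCoeffs_tsum a).isHardy (summable_sq_lp a))
  map_add' a b := Hardy.ext fun z hz => by
    rw [add_apply, mk_apply _ hz, mk_apply _ hz, mk_apply _ hz,
      ← (hasCoeffs_tsum a z hz).summable.tsum_add (hasCoeffs_tsum b z hz).summable]
    exact tsum_congr fun n => by simp [add_mul]
  map_smul' c a := Hardy.ext fun z hz => by
    rw [smul_apply, mk_apply _ hz, mk_apply _ hz, ← tsum_mul_left]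
    exact tsum_congr fun n => by simp [mul_assoc]

theorem hasCoeffs_ofCoeffs (a : lp (fun _ : ℕ => ℂ) 2) : HasCoeffs (ofCoeffs a) a := by
  intro z hz
  have := hasCoeffs_tsum a z hz
  exact mk_apply ((hasCoeffs_tsum a).isHardy (summable_sq_lp a)) hz ▸ this

theorem inner_ofCoeffs (a b : lp (fun _ : ℕ => ℂ) 2) :
    inner ℂ (ofCoeffs a) (ofCoeffs b) = inner ℂ a b := by
  refine (inner_eq_tsum_of_hasCoeffs (hasCoeffs_ofCoeffs a) (hasCoeffs_ofCoeffs b)).trans ?_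
  rw [lp.inner_eq_tsum]
  exact tsum_congr fun n => by simp [mul_comm]

theorem ofCoeffs_surjective : Function.Surjective ofCoeffs := by
  intro f
  refine ⟨⟨taylorCoeff f, memℓp_gen (by simpa using f.summable_sq)⟩, Hardy.ext fun z hz => ?_⟩
  exact (hasCoeffs_ofCoeffs _ z hz).unique (f.hasCoeffs z hz)

instance : CompleteSpace Hardy := by
  have h := (ofCoeffs.isometryOfInner inner_ofCoeffs).isometry
  exact (h.isUniformInducing.completeSpace_congr ofCoeffs_surjective).mp inferInstance

end Hardy

theorem norm_sq_lp (b : lp (fun _ : ℕ => ℂ) 2) : ‖b‖ ^ 2 = ∑' n, ‖b n‖ ^ 2 := by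
  simpa using lp.norm_rpow_eq_tsum (p := 2) (by norm_num) b

/-- The backward shift on `ℓ²`. -/
noncomputable def backwardShift : lp (fun _ : ℕ => ℂ) 2 →L[ℂ] lp (fun _ : ℕ => ℂ) 2 :=
  LinearMap.mkContinuous
    { toFun := fun a => ⟨fun n => a (n + 1), memℓp_gen (by
        simpa using (summable_nat_add_iff 1).mpr (Hardy.summable_sq_lp a))⟩
      map_add' := fun _ _ => rfl
      map_smul' := fun _ _ => rfl } 1 fun a => by
    rw [one_mul]
    refine abs_le_of_sq_le_sq' ?_ (norm_nonneg _) |>.2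
    rw [norm_sq_lp, norm_sq_lp, (Hardy.summable_sq_lp a).tsum_eq_zero_add]
    exact le_add_of_nonneg_left (sq_nonneg _)

theorem backwardShift_apply (a : lp (fun _ : ℕ => ℂ) 2) (n : ℕ) :
    backwardShift a n = a (n + 1) := rfl

theorem norm_sq_backwardShift (a : lp (fun _ : ℕ => ℂ) 2) :
    ‖backwardShift a‖ ^ 2 = ‖a‖ ^ 2 - ‖a 0‖ ^ 2 := by
  rw [norm_sq_lp, norm_sq_lp, (Hardy.summable_sq_lp a).tsum_eq_zero_add]
  simp [backwardShift_apply]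

theorem norm_backwardShift_le : ‖backwardShift‖ ≤ 1 :=
  LinearMap.mkContinuous_norm_le _ zero_le_one _

/-- The square of the modulus of a function in `H²` is dominated on the disc by the real part of a
holomorphic function. -/
theorem IsHardy.exists_majorant {f : ℂ → ℂ} (hf : IsHardy f) :
    ∃ h : ℂ → ℂ, DifferentiableOn ℂ h (ball 0 1) ∧ ∀ w : ℂ, ‖w‖ < 1 → ‖f w‖ ^ 2 ≤ (h w).re := by
  have hc := hasCoeffs_taylorCoeff hf.1
  let a : lp (fun _ : ℕ => ℂ) 2 :=
    ⟨taylorCoeff f, memℓp_gen (by simpa using hf.summable_sq hc)⟩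
  let G : ℂ → (lp (fun _ : ℕ => ℂ) 2 →L[ℂ] lp (fun _ : ℕ => ℂ) 2) :=
    fun w => Ring.inverse (1 - w • backwardShift)
  have hu : ∀ w : ℂ, ‖w‖ < 1 → IsUnit (1 - w • backwardShift) := fun w hw => by
    refine isUnit_one_sub_of_norm_lt_one ?_
    rw [norm_smul]
    nlinarith [norm_backwardShift_le, norm_nonneg w, norm_nonneg backwardShift]
  have hG : DifferentiableOn ℂ G (ball 0 1) := fun w hw => by
    obtain ⟨u, hu'⟩ := hu w (by simpa using hw)
    have h1 : DifferentiableAt ℂ Ring.inverse (1 - w • backwardShift) :=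
      hu' ▸ differentiableAt_inverse u.isUnit
    have h2 : DifferentiableAt ℂ (fun w : ℂ => 1 - w • backwardShift) w := by fun_prop
    exact (h1.comp w h2).differentiableWithinAt
  refine ⟨fun w => innerSL ℂ a (((1 + w • backwardShift) * G w) a), ?_, fun w hw => ?_⟩
  · refine (innerSL ℂ a).differentiable.comp_differentiableOn ?_
    refine DifferentiableOn.clm_apply (DifferentiableOn.mul ?_ hG) (differentiableOn_const _)
    fun_prop
  · set g := G w a with hg
    have hga : g - w • backwardShift g = a := by
      have := congrArg (fun T : lp (fun _ : ℕ => ℂ) 2 →L[ℂ] lp (fun _ : ℕ => ℂ) 2 => T a)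
        (Ring.mul_inverse_cancel _ (hu w hw))
      simpa using this
    have hcoef : ∀ n, taylorCoeff f n = g n - w * g (n + 1) := fun n => by
      have := congrArg (fun b : lp (fun _ : ℕ => ℂ) 2 => b n) hga
      exact this.symm
    have hg0 : f w = g 0 := by
      have h1 := (hc w hw).tendsto_sum_nat
      have h2 : ∀ N, ∑ n ∈ Finset.range N, taylorCoeff f n * w ^ n = g 0 - w ^ N * g N := by
        intro N
        induction N with
        | zero => simp
        | succ N ih => rw [Finset.sum_range_succ, ih, hcoef, pow_succ]; ring
      simp only [h2] at h1
      have h3 : Tendsto (fun N => w ^ N * g N) atTop (𝓝 0) := by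
        refine squeeze_zero_norm (fun N => ?_)
          (by simpa using (tendsto_pow_atTop_nhds_zero_of_lt_one (norm_nonneg w) hw).mul_const ‖g‖)
        rw [norm_mul, norm_pow]
        gcongr
        exact lp.norm_apply_le_norm two_ne_zero g N
      exact tendsto_nhds_unique h1 (by simpa using tendsto_const_nhds.sub h3)
    have hval : innerSL ℂ a (((1 + w • backwardShift) * G w) a)
        = inner ℂ (g - w • backwardShift g) (g + w • backwardShift g) := by
      rw [hga]
      rfl
    simp only [hval]
    have hre : (inner ℂ (g - w • backwardShift g) (g + w • backwardShift g)).re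
        = ‖g‖ ^ 2 - ‖w • backwardShift g‖ ^ 2 := by
      rw [inner_sub_left, inner_add_right, inner_add_right, ← inner_conj_symm g (w • backwardShift g)]
      have e1 : (inner ℂ g g).re = ‖g‖ ^ 2 := inner_self_eq_norm_sq (𝕜 := ℂ) g
      have e2 : (inner ℂ (w • backwardShift g) (w • backwardShift g)).re
        = ‖w • backwardShift g‖ ^ 2 := inner_self_eq_norm_sq (𝕜 := ℂ) _
      simp only [Complex.sub_re, Complex.add_re, Complex.conj_re, e1, e2]
      ring
    rw [hre, norm_smul, mul_pow, norm_sq_backwardShift, hg0]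
    have hw2 : ‖w‖ ^ 2 ≤ 1 := pow_le_one₀ (norm_nonneg w) hw.le
    have := norm_sq_backwardShift g
    nlinarith [sq_nonneg ‖backwardShift g‖]

/-- The weight of the conjugation. -/
noncomputable def kappa (μ z : ℂ) : ℂ := (√(1 - ‖μ‖ ^ 2) : ℝ) / (1 - z * conj μ)

/-- The Möbius self-map of the disc used in the conjugation. -/
noncomputable def phi (μ z : ℂ) : ℂ := conj μ / μ * ((μ - z) / (1 - z * conj μ))

theorem one_sub_ne_zero {μ z : ℂ} (hμ : ‖μ‖ < 1) (hz : ‖z‖ < 1) : 1 - z * conj μ ≠ 0 := by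
  intro h
  have h1 : ‖z * conj μ‖ = 1 := by rw [← sub_eq_zero.mp h]; simp
  rw [norm_mul, RCLike.norm_conj] at h1
  nlinarith [norm_nonneg μ, norm_nonneg z]

theorem norm_phi_lt {μ z : ℂ} (hμ : ‖μ‖ < 1) (hz : ‖z‖ < 1) : ‖phi μ z‖ < 1 := by
  have h0 := one_sub_ne_zero hμ hz
  have h1 : ‖conj μ / μ‖ ≤ 1 := by
    rw [norm_div, RCLike.norm_conj]
    exact div_self_le_one _
  have h2 : ‖(μ - z) / (1 - z * conj μ)‖ < 1 := by
    rw [norm_div, div_lt_one (norm_pos_iff.mpr h0)]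
    refine lt_of_pow_lt_pow_left₀ 2 (norm_nonneg _) ?_
    have hμ2 : ‖μ‖ ^ 2 < 1 := by nlinarith [norm_nonneg μ]
    have hz2 : ‖z‖ ^ 2 < 1 := by nlinarith [norm_nonneg z]
    have key : ‖1 - z * conj μ‖ ^ 2 - ‖μ - z‖ ^ 2 = (1 - ‖μ‖ ^ 2) * (1 - ‖z‖ ^ 2) := by
      simp only [← Complex.normSq_eq_norm_sq, Complex.normSq_apply, Complex.sub_re, Complex.sub_im,
        Complex.mul_re, Complex.mul_im, Complex.conj_re, Complex.conj_im, Complex.one_re,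
        Complex.one_im]
      ring
    nlinarith [mul_pos (sub_pos.mpr hμ2) (sub_pos.mpr hz2)]
  rw [phi, norm_mul]
  nlinarith [norm_nonneg (conj μ / μ), norm_nonneg ((μ - z) / (1 - z * conj μ))]

theorem differentiableAt_conj_comp {f : ℂ → ℂ} (hf : DifferentiableOn ℂ f (ball 0 1)) {μ z : ℂ}
    (hμ : ‖μ‖ < 1) (hz : ‖z‖ < 1) :
    DifferentiableAt ℂ (fun z => conj (f (conj (phi μ z)))) z := by
  have h0 := one_sub_ne_zero hμ hz
  have h1 : DifferentiableAt ℂ f (conj (phi μ z)) :=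
    hf.differentiableAt (isOpen_ball.mem_nhds (by simpa using norm_phi_lt hμ hz))
  have h2 := h1.conj_conj
  rw [Complex.conj_conj] at h2
  have h3 : DifferentiableAt ℂ (phi μ) z := by
    unfold phi
    fun_prop (disch := assumption)
  exact h2.comp z h3

/-- The anti-linear weighted composition transform of a function. -/
noncomputable def JFun (β μ : ℂ) (f : ℂ → ℂ) (z : ℂ) : ℂ :=
  β * kappa μ z * conj (f (conj (phi μ z)))

theorem IsHardy.jFun {f : ℂ → ℂ} (hf : IsHardy f) (β : ℂ) {μ : ℂ} (hμ : ‖μ‖ < 1) :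
    IsHardy (JFun β μ f) := by
  have hd : DifferentiableOn ℂ (JFun β μ f) (ball 0 1) := fun z hz => by
    rw [mem_ball_zero_iff] at hz
    have h0 := one_sub_ne_zero hμ hz
    have h1 : DifferentiableAt ℂ (fun z => β * kappa μ z) z := by
      unfold kappa
      fun_prop (disch := assumption)
    exact (h1.mul (differentiableAt_conj_comp hf.1 hμ hz)).differentiableWithinAt
  refine ⟨hd, ?_⟩
  obtain ⟨h, hh, hle⟩ := hf.exists_majorant
  set H : ℂ → ℂ := fun z => conj (h (conj (phi μ z))) with hH
  have hHd : DifferentiableOn ℂ H (ball 0 1) := fun z hz =>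
    (differentiableAt_conj_comp hh hμ (by simpa using hz)).differentiableWithinAt
  set K : ℝ := ‖β‖ * (√(1 - ‖μ‖ ^ 2) / (1 - ‖μ‖)) with hK
  refine ⟨(((K ^ 2 : ℝ) : ℂ) * H 0).re, fun r hr => ?_⟩
  have hsub : closedBall (0 : ℂ) r ⊆ ball 0 1 := closedBall_subset_ball hr.2
  have hsph : sphere (0 : ℂ) |r| ⊆ ball 0 1 := by
    rw [abs_of_nonneg hr.1]
    exact sphere_subset_closedBall.trans hsub
  have havg : circleAverage (fun z => ((K ^ 2 : ℝ) : ℂ) * H z) 0 r = ((K ^ 2 : ℝ) : ℂ) * H 0 := by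
    refine DiffContOnCl.circleAverage (f := fun z => ((K ^ 2 : ℝ) : ℂ) * H z) ?_
    refine DifferentiableOn.diffContOnCl ?_
    refine (hHd.const_mul _).mono ?_
    rw [abs_of_nonneg hr.1]
    exact closure_ball_subset_closedBall.trans hsub
  have hci : CircleIntegrable (fun z => ((K ^ 2 : ℝ) : ℂ) * H z) 0 r :=
    ((hHd.const_mul _).continuousOn.mono hsph).circleIntegrable'
  have hre : circleAverage (fun z => (((K ^ 2 : ℝ) : ℂ) * H z).re) 0 r
      = (((K ^ 2 : ℝ) : ℂ) * H 0).re := by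
    rw [← havg]
    exact Complex.reCLM.circleAverage_comp_comm hci
  rw [← hre]
  refine circleAverage_mono ?_ ?_ fun z hz => ?_
  · exact ((hd.continuousOn.mono hsph).norm.pow 2).circleIntegrable'
  · exact (Complex.continuous_re.comp_continuousOn
      ((hHd.const_mul _).continuousOn.mono hsph)).circleIntegrable'
  · have hz1 : ‖z‖ < 1 := by simpa using hsph hz
    have h1 := hle (conj (phi μ z)) (by simpa using norm_phi_lt hμ hz1)
    have h2 : ‖β * kappa μ z‖ ≤ K := by
      rw [norm_mul, kappa, norm_div, Complex.norm_real, Real.norm_of_nonneg (Real.sqrt_nonneg _), hK]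
      have h3 : 1 - ‖μ‖ ≤ ‖1 - z * conj μ‖ := by
        have := norm_sub_norm_le (1 : ℂ) (z * conj μ)
        rw [norm_one, norm_mul, RCLike.norm_conj] at this
        nlinarith [norm_nonneg μ]
      have h4 : 0 < 1 - ‖μ‖ := by linarith
      gcongr
    have h3 : (((K ^ 2 : ℝ) : ℂ) * H z).re = K ^ 2 * (h (conj (phi μ z))).re := by
      rw [Complex.re_ofReal_mul, hH, Complex.conj_re]
    simp only [JFun]
    rw [h3, norm_mul, mul_pow, RCLike.norm_conj]
    gcongr

/-- The conjugation `J_{β,μ}` on `H²`: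
`J f (z) = β κ(z) conj (f (conj (φ z)))` for `z` in the disc, where `κ = kappa μ`, `φ = phi μ`. -/
noncomputable def J (β μ : ℂ) (hμ : ‖μ‖ < 1) : Hardy →ₛₗ[starRingEnd ℂ] Hardy where
  toFun f := Hardy.mk (JFun β μ f) (f.isHardy.jFun β hμ)
  map_add' f g := Hardy.ext fun z hz => by
    rw [Hardy.add_apply, Hardy.mk_apply _ hz, Hardy.mk_apply _ hz, Hardy.mk_apply _ hz]
    simp only [JFun, Hardy.add_apply, map_add]
    ring
  map_smul' c f := Hardy.ext fun z hz => by
    rw [Hardy.smul_apply, Hardy.mk_apply _ hz, Hardy.mk_apply _ hz]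
    simp only [JFun, Hardy.smul_apply, map_mul]
    ring

/-- The maximal differential operator `f ↦ ψ₀ f + ψ₁ f'` on `H²`: its domain consists of all `f` in
`H²` for which `ψ₀ f + ψ₁ f'` is in `H²`. -/
noncomputable def maximalOp (ψ₀ ψ₁ : ℂ → ℂ) : Hardy →ₗ.[ℂ] Hardy where
  domain :=
    { carrier := {f | IsHardy fun z => ψ₀ z * f z + ψ₁ z * deriv f z}
      add_mem' := fun {f g} hf hg => (hf.add hg).congr fun z hz => by
        rw [mem_ball_zero_iff] at hz
        have : deriv (f + g : Hardy) z = deriv f z + deriv g z :=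
          deriv_add (f.differentiableAt hz) (g.differentiableAt hz)
        simp only [Hardy.add_apply, this]
        ring
      zero_mem' := isHardy_zero.congr fun z _ => by
        have : deriv (0 : Hardy) z = 0 := deriv_const z (0 : ℂ)
        simp [this]
      smul_mem' := fun c f hf => (hf.const_mul c).congr fun z hz => by
        rw [mem_ball_zero_iff] at hz
        have : deriv (c • f : Hardy) z = c * deriv f z := deriv_const_mul c (f.differentiableAt hz)
        simp only [Hardy.smul_apply, this]
        ring }
  toFun :=
    { toFun := fun f => Hardy.mk _ f.2
      map_add' := fun f g => Hardy.ext fun z hz => by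
        have : deriv (f.1 + g.1 : Hardy) z = deriv f.1 z + deriv g.1 z :=
          deriv_add (f.1.differentiableAt hz) (g.1.differentiableAt hz)
        rw [Hardy.add_apply, Hardy.mk_apply _ hz, Hardy.mk_apply _ hz, Hardy.mk_apply _ hz]
        simp only [Submodule.coe_add, Hardy.add_apply, this]
        ring
      map_smul' := fun c f => Hardy.ext fun z hz => by
        have : deriv (c • f.1 : Hardy) z = c * deriv f.1 z :=
          deriv_const_mul c (f.1.differentiableAt hz)
        rw [RingHom.id_apply, Hardy.smul_apply, Hardy.mk_apply _ hz, Hardy.mk_apply _ hz]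
        simp only [Submodule.coe_smul, Hardy.smul_apply, this]
        ring }

/-- The operator `C T C`, for an anti-linear map `C` defined on the whole space, with its natural
domain `{x | C x ∈ dom T}`. -/
noncomputable def conjOp {V : Type*} [AddCommGroup V] [Module ℂ V] (C : V →ₛₗ[starRingEnd ℂ] V)
    (T : V →ₗ.[ℂ] V) : V →ₗ.[ℂ] V where
  domain := T.domain.comap C
  toFun :=
    { toFun := fun x => C (T ⟨C x, x.2⟩)
      map_add' := fun x y => by
        rw [← map_add, ← LinearPMap.map_add]
        congr 2
        exact Subtype.ext (map_add C _ _)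
      map_smul' := fun c x => by
        have : (⟨C ((c • x : T.domain.comap C) : V), (c • x).2⟩ : T.domain)
            = conj c • ⟨C x, x.2⟩ := Subtype.ext (C.map_smulₛₗ c x)
        rw [this, LinearPMap.map_smul, C.map_smulₛₗ]
        simp }

/-- A linear operator `S` is `C`-selfadjoint if it is densely defined and `S = C S* C`. -/
def IsCSelfAdjoint {V : Type*} [NormedAddCommGroup V] [InnerProductSpace ℂ V] [CompleteSpace V]
    (C : V →ₛₗ[starRingEnd ℂ] V) (S : V →ₗ.[ℂ] V) : Prop :=
  Dense (S.domain : Set V) ∧ S = conjOp C S.adjoint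

end HardyDiff

/-!
A reproducing kernel `K_v` of `H²` lies in the domain of the adjoint of every densely defined
operator `E` contained in the maximal operator `T`, with
`E* K_v = conj (ψ₀ v) K_v + conj (ψ₁ v) K_v'`, where `K_v'` represents `f ↦ f' v`
(`exists_adjoint_kernel`). If `E = J E* J`, then `J K_v` lies in the domain of `E`, and evaluating
`E J K_v = J E* K_v` at `u` gives a functional equation for `ψ₀` and `ψ₁`
(`IsCSelfAdjoint.symbol_eq`). Its instances `v = μ` and `v = 0` force the polynomial form of the
symbols with the relation between the coefficients (`IsCSelfAdjoint.exists_symbol`).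

Conversely, let `ψ₀ = a + b z` and `ψ₁ = d + c z + b z²`. In the basis of monomials `T` acts by a
tridiagonal matrix whose entries grow linearly (`quadCoeff`). The conjugate transposed matrix belongs
to a maximal operator `S` of the same shape. Summation by parts compares `⟪T f, g⟫` with
`⟪f, S g⟫` up to boundary terms, which tend to zero along the maximal domains by Carleman's
argument: they converge and are bounded by `n y_n` with `y` summable (`tsum_quadCoeff`). Hence
`T* = S` with equal domains (`adjoint_quadOp`). The relation between the coefficients says that the
conjugation intertwines the differential expressions of `T` and `S` (`jFun_quad`), so
`T = J S J = J T* J` (`quadOp_eq_conjOp`).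

The two parts combine: if `E = J E* J` and `E ≤ T`, then the symbols have this form and
`T = J T* J ≤ J E* J = E`, so `E = T`.
-/

namespace HardyDiff

open ComplexConjugate Complex Metric Set Filter Topology

/-! ### Taylor coefficients -/

/-- The coefficients of a convergent power series are determined by its sum: the mean square of the
difference of two expansions over the circle of radius `1 / 2` vanishes. -/
theorem HasCoeffs.unique {f : ℂ → ℂ} {a b : ℕ → ℂ} (ha : HasCoeffs f a) (hb : HasCoeffs f b) :
    a = b := by
  have h : HasCoeffs (fun _ => 0) fun n => a n - b n := fun z hz => by
    simpa [sub_mul] using (ha z hz).sub (hb z hz)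
  have h1 := h.hasSum_sq_mean (r := 1 / 2) (by norm_num)
  have h2 : Real.circleAverage (fun _ : ℂ => ‖(0 : ℂ)‖ ^ 2) 0 (1 / 2) = 0 := by
    simp [Real.circleAverage]
  rw [h2, hasSum_zero_iff_of_nonneg fun n => by positivity] at h1
  funext n
  have h3 := congrFun h1 n
  simpa [sub_eq_zero] using h3

theorem HasCoeffs.congr {f g : ℂ → ℂ} {a : ℕ → ℂ} (hf : HasCoeffs f a)
    (h : ∀ z : ℂ, ‖z‖ < 1 → f z = g z) : HasCoeffs g a := fun z hz => h z hz ▸ hf z hz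

theorem HasCoeffs.eq {f g : ℂ → ℂ} {a : ℕ → ℂ} (hf : HasCoeffs f a) (hg : HasCoeffs g a) {z : ℂ}
    (hz : ‖z‖ < 1) : f z = g z := (hf z hz).unique (hg z hz)

theorem HasCoeffs.add {f g : ℂ → ℂ} {a b : ℕ → ℂ} (hf : HasCoeffs f a) (hg : HasCoeffs g b) :
    HasCoeffs (fun z => f z + g z) fun n => a n + b n := fun z hz => by
  simpa [add_mul] using (hf z hz).add (hg z hz)

theorem HasCoeffs.const_mul {f : ℂ → ℂ} {a : ℕ → ℂ} (c : ℂ) (hf : HasCoeffs f a) :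
    HasCoeffs (fun z => c * f z) fun n => c * a n := fun z hz => by
  simpa [mul_assoc] using (hf z hz).mul_left c

theorem HasCoeffs.deriv {f : ℂ → ℂ} {a : ℕ → ℂ} (hf : HasCoeffs f a) :
    HasCoeffs (deriv f) fun n => (n + 1) * a (n + 1) := by
  have h := hasCoeffs_taylorCoeff (hf.differentiableOn.deriv isOpen_ball)
  rw [hf.unique (hasCoeffs_taylorCoeff hf.differentiableOn)]
  convert h using 2 with n
  rw [taylorCoeff, taylorCoeff, iteratedDeriv_succ', Nat.factorial_succ]
  have h1 : (n.factorial : ℂ) ≠ 0 := by exact_mod_cast n.factorial_ne_zero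
  have h2 : (n + 1 : ℂ) ≠ 0 := by exact_mod_cast n.succ_ne_zero
  push_cast
  field_simp

/-- If `f` has coefficients `a`, then `z f'(z)` has coefficients `n a_n`. -/
theorem HasCoeffs.mul_deriv {f : ℂ → ℂ} {a : ℕ → ℂ} (hf : HasCoeffs f a) :
    HasCoeffs (fun z => z * _root_.deriv f z) fun n => n * a n := fun z hz => by
  have h := (hf.deriv z hz).mul_left z
  rw [← hasSum_nat_add_iff' 1]
  simpa [pow_succ', mul_assoc, mul_left_comm] using h

/-- If `f` has coefficients `a`, then `z (z f)'(z)` has coefficients `n a_{n-1}`. At `n = 0` the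
factor `n` cancels the truncated index. -/
theorem HasCoeffs.mul_deriv_mul {f : ℂ → ℂ} {a : ℕ → ℂ} (hf : HasCoeffs f a) :
    HasCoeffs (fun z => z * (z * _root_.deriv f z + f z)) fun n => n * a (n - 1) := fun z hz => by
  have h := ((hf.mul_deriv.add hf) z hz).mul_left z
  rw [← hasSum_nat_add_iff' 1]
  have h0 : ∑ n ∈ Finset.range 1, (n : ℂ) * a (n - 1) * z ^ n = 0 := by simp
  rw [h0, sub_zero]
  refine h.congr_fun fun n => ?_
  simp only [Nat.add_sub_cancel, Nat.cast_add, Nat.cast_one]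
  ring

theorem hasCoeffs_pow (n : ℕ) : HasCoeffs (fun z => z ^ n) (Pi.single n 1) := fun z _ => by
  have h := hasSum_single (f := fun k => (Pi.single n (1 : ℂ) : ℕ → ℂ) k * z ^ k) n
    fun k hk => by simp [hk]
  simpa using h

/-! ### Reproducing kernels -/

theorem hasCoeffs_inv {v : ℂ} (hv : ‖v‖ < 1) :
    HasCoeffs (fun z => (1 - conj v * z)⁻¹) fun n => conj v ^ n := fun z hz => by
  have h : ‖conj v * z‖ < 1 := by
    rw [norm_mul, RCLike.norm_conj]
    nlinarith [norm_nonneg v, norm_nonneg z]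
  simpa [mul_pow] using hasSum_geometric_of_norm_lt_one h

theorem one_sub_conj_mul_ne_zero {v z : ℂ} (hv : ‖v‖ < 1) (hz : ‖z‖ < 1) :
    1 - conj v * z ≠ 0 := mul_comm z (conj v) ▸ one_sub_ne_zero hv hz

theorem hasDerivAt_kernel {v z : ℂ} (hv : ‖v‖ < 1) (hz : ‖z‖ < 1) :
    HasDerivAt (fun z => (1 - conj v * z)⁻¹) (conj v / (1 - conj v * z) ^ 2) z := by
  have h := (((hasDerivAt_id z).const_mul (conj v)).const_sub 1).inv
    (one_sub_conj_mul_ne_zero hv hz)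
  rw [mul_one, neg_neg] at h
  exact h

theorem hasCoeffs_deriv_kernel {v : ℂ} (hv : ‖v‖ < 1) :
    HasCoeffs (fun z => z / (1 - conj v * z) ^ 2) fun n => n * conj v ^ (n - 1) :=
  (hasCoeffs_inv hv).mul_deriv_mul.congr fun z hz => by
    rw [(hasDerivAt_kernel hv hz).deriv]
    field_simp
    ring

/-- The reproducing kernel of `H²` at `v`. -/
noncomputable def kernel (v : ℂ) (hv : ‖v‖ < 1) : Hardy :=
  Hardy.mk (fun z => (1 - conj v * z)⁻¹) <| (hasCoeffs_inv hv).isHardy <| by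
    have h : ‖v‖ ^ 2 < 1 := by nlinarith [norm_nonneg v]
    simpa [← pow_mul, mul_comm] using summable_geometric_of_lt_one (sq_nonneg _) h

theorem summable_sq_natCast_mul_pow {v : ℂ} (hv : ‖v‖ < 1) :
    Summable fun n : ℕ => ‖(n : ℂ) * conj v ^ (n - 1)‖ ^ 2 := by
  have h : ‖‖v‖ ^ 2‖ < 1 := by
    rw [Real.norm_of_nonneg (sq_nonneg _)]
    exact pow_lt_one₀ (norm_nonneg v) hv two_ne_zero
  rcases eq_or_ne v 0 with rfl | h0
  · refine summable_of_ne_finset_zero (s := {0, 1}) fun n hn => ?_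
    have : n - 1 ≠ 0 := by simp at hn; omega
    simp [this]
  have h2 : ‖v‖ ≠ 0 := norm_ne_zero_iff.mpr h0
  refine ((summable_pow_mul_geometric_of_norm_lt_one 2 h).mul_left ((‖v‖ ^ 2)⁻¹)).congr fun n => ?_
  rcases n with _ | n
  · simp
  rw [norm_mul, norm_pow, RCLike.norm_conj, Complex.norm_natCast, Nat.add_sub_cancel, ← pow_mul,
    mul_pow, ← pow_mul, eq_comm, ← div_eq_inv_mul, eq_div_iff (pow_ne_zero 2 h2)]
  ring

/-- The element of `H²` that represents the functional `f ↦ f' v`. -/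
noncomputable def derivKernel (v : ℂ) (hv : ‖v‖ < 1) : Hardy :=
  Hardy.mk (fun z => z / (1 - conj v * z) ^ 2)
    ((hasCoeffs_deriv_kernel hv).isHardy (summable_sq_natCast_mul_pow hv))

theorem kernel_apply {v z : ℂ} (hv : ‖v‖ < 1) (hz : ‖z‖ < 1) :
    kernel v hv z = (1 - conj v * z)⁻¹ := Hardy.mk_apply _ hz

theorem derivKernel_apply {v z : ℂ} (hv : ‖v‖ < 1) (hz : ‖z‖ < 1) :
    derivKernel v hv z = z / (1 - conj v * z) ^ 2 := Hardy.mk_apply _ hz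

theorem inner_kernel {v : ℂ} (hv : ‖v‖ < 1) (f : Hardy) : inner ℂ (kernel v hv) f = f v := by
  have h : HasCoeffs (kernel v hv) fun n => conj v ^ n :=
    (hasCoeffs_inv hv).congr fun z hz => (kernel_apply hv hz).symm
  rw [Hardy.inner_eq_tsum_of_hasCoeffs h f.hasCoeffs, ← (f.hasCoeffs v hv).tsum_eq]
  exact tsum_congr fun n => by simp [mul_comm]

theorem inner_derivKernel {v : ℂ} (hv : ‖v‖ < 1) (f : Hardy) :
    inner ℂ (derivKernel v hv) f = deriv f v := by
  have h : HasCoeffs (derivKernel v hv) fun n => n * conj v ^ (n - 1) :=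
    (hasCoeffs_deriv_kernel hv).congr fun z hz => (derivKernel_apply hv hz).symm
  rw [Hardy.inner_eq_tsum_of_hasCoeffs h f.hasCoeffs, ← (f.hasCoeffs.deriv v hv).tsum_eq]
  have h0 : ∑ n ∈ Finset.range 1, conj ((n : ℂ) * conj v ^ (n - 1)) * taylorCoeff f n = 0 := by simp
  rw [← Summable.sum_add_tsum_nat_add 1, h0, zero_add]
  · exact tsum_congr fun n => by simp; ring
  · rw [← summable_nat_add_iff 1]
    exact (f.hasCoeffs.deriv v hv).summable.congr fun n => by simp; ring

/-! ### Differential operators with tridiagonal matrix -/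

/-- The maximal operator with symbols `a + b z` and `d + c z + b z²`. The coefficient `b` is shared
by the two symbols: this makes the matrix of the operator in the monomials tridiagonal. -/
noncomputable def quadOp (a b c d : ℂ) : Hardy →ₗ.[ℂ] Hardy :=
  maximalOp (fun z => a + b * z) fun z => d + c * z + b * z ^ 2

/-- The tridiagonal matrix of `quadOp`, acting on sequences of Taylor coefficients. -/
def quadCoeff (a b c d : ℂ) (x : ℕ → ℂ) (n : ℕ) : ℂ :=
  d * ((n + 1) * x (n + 1)) + (a * x n + c * (n * x n)) + b * (n * x (n - 1))

theorem HasCoeffs.quad {f : ℂ → ℂ} {x : ℕ → ℂ} (hf : HasCoeffs f x) (a b c d : ℂ) :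
    HasCoeffs (fun z => (a + b * z) * f z + (d + c * z + b * z ^ 2) * _root_.deriv f z)
      (quadCoeff a b c d x) :=
  ((((hf.deriv.const_mul d).add ((hf.const_mul a).add (hf.mul_deriv.const_mul c))).add
    (hf.mul_deriv_mul.const_mul b))).congr fun z _ => by ring

theorem maximalOp_apply {ψ₀ ψ₁ : ℂ → ℂ} (f : (maximalOp ψ₀ ψ₁).domain) {z : ℂ} (hz : ‖z‖ < 1) :
    maximalOp ψ₀ ψ₁ f z = ψ₀ z * (f : Hardy) z + ψ₁ z * deriv (f : Hardy) z :=
  Hardy.mk_apply f.2 hz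

theorem hasCoeffs_quadOp {a b c d : ℂ} (f : (quadOp a b c d).domain) :
    HasCoeffs (quadOp a b c d f) (quadCoeff a b c d (taylorCoeff (f : Hardy))) :=
  ((f : Hardy).hasCoeffs.quad a b c d).congr fun _ hz => (maximalOp_apply f hz).symm

theorem maximalOp_congr {ψ₀ ψ₁ χ₀ χ₁ : ℂ → ℂ} (h₀ : EqOn ψ₀ χ₀ (ball 0 1))
    (h₁ : EqOn ψ₁ χ₁ (ball 0 1)) : maximalOp ψ₀ ψ₁ = maximalOp χ₀ χ₁ := by
  have key : ∀ f : Hardy, EqOn (fun z => ψ₀ z * f z + ψ₁ z * deriv f z)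
      (fun z => χ₀ z * f z + χ₁ z * deriv f z) (ball 0 1) := fun f z hz => by
    simp only [h₀ hz, h₁ hz]
  refine LinearPMap.ext (Submodule.ext fun f => ⟨fun h => IsHardy.congr h (key f),
    fun h => IsHardy.congr h (key f).symm⟩) fun f hf hg => Hardy.ext fun z hz => ?_
  rw [maximalOp_apply _ hz, maximalOp_apply _ hz]
  exact key f (by simpa using hz)

/-! ### Carleman's condition -/

/-- A sequence bounded by `n y_n` with `y` summable has no limit other than `0`, because the harmonic
series diverges. -/
theorem eq_zero_of_tendsto_of_norm_le {X : ℕ → ℂ} {y : ℕ → ℝ} {L : ℂ}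
    (hX : Tendsto X atTop (𝓝 L)) (hy : Summable y) (hle : ∀ n, ‖X n‖ ≤ n * y n) : L = 0 := by
  by_contra hL
  have hL' : 0 < ‖L‖ / 2 := by positivity
  have h1 : ∀ᶠ n in atTop, ‖L‖ / 2 < ‖X n‖ :=
    hX.norm.eventually_const_lt (by linarith)
  obtain ⟨N, hN⟩ := eventually_atTop.mp (h1.and (eventually_gt_atTop 0))
  refine Real.not_summable_one_div_natCast ?_
  rw [← summable_nat_add_iff N]
  refine Summable.of_nonneg_of_le (fun n => by positivity) (fun n => ?_)
    (((summable_nat_add_iff N).mpr hy).mul_left (‖L‖ / 2)⁻¹)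
  obtain ⟨h2, h3⟩ := hN (n + N) (by omega)
  have h4 : (0 : ℝ) < ((n + N : ℕ) : ℝ) := by exact_mod_cast h3
  have h5 := hle (n + N)
  rw [div_le_iff₀ h4, mul_assoc, ← div_eq_inv_mul, le_div_iff₀ hL']
  linarith

/-- The matrix of `quadOp` and its conjugate transpose are adjoint to each other, without any
assumption on decay beyond what gives both sides a meaning. The partial sums of the difference are
the boundary terms at `N` of a summation by parts. These converge, and are at most `N` times a
summable sequence: this is Carleman's condition for a Jacobi matrix of linear growth. -/
theorem tsum_quadCoeff {a b c d : ℂ} {x y : ℕ → ℂ} (hx : Summable fun n => ‖x n‖ ^ 2)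
    (hy : Summable fun n => ‖y n‖ ^ 2)
    (h₁ : Summable fun n => conj (quadCoeff a b c d x n) * y n)
    (h₂ : Summable fun n => conj (x n) * quadCoeff (conj a) (conj d) (conj c) (conj b) y n) :
    ∑' n, conj (quadCoeff a b c d x n) * y n
      = ∑' n, conj (x n) * quadCoeff (conj a) (conj d) (conj c) (conj b) y n := by
  set X : ℕ → ℂ := fun n =>
    conj d * (n * (conj (x n) * y (n - 1))) - conj b * (n * (conj (x (n - 1)) * y n)) with hXdef
  have hsum : ∀ N, ∑ n ∈ Finset.range N, (conj (quadCoeff a b c d x n) * y n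
      - conj (x n) * quadCoeff (conj a) (conj d) (conj c) (conj b) y n) = X N := by
    intro N
    induction N with
    | zero => simp [hXdef]
    | succ N ih =>
      rw [Finset.sum_range_succ, ih]
      simp only [hXdef, quadCoeff, map_add, map_mul, map_natCast, map_one, Nat.add_sub_cancel]
      push_cast
      ring
  have hX : Tendsto X atTop (𝓝 (∑' n, (conj (quadCoeff a b c d x n) * y n
      - conj (x n) * quadCoeff (conj a) (conj d) (conj c) (conj b) y n))) := by
    simpa only [hsum] using (h₁.sub h₂).hasSum.tendsto_sum_nat
  rw [← sub_eq_zero, ← h₁.tsum_sub h₂]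
  have hpred : ∀ {u : ℕ → ℂ}, (Summable fun n => ‖u n‖ ^ 2) → Summable fun n => ‖u (n - 1)‖ ^ 2 :=
    fun hu => (summable_nat_add_iff 1).mp (by simpa using hu)
  refine eq_zero_of_tendsto_of_norm_le hX
    (((summable_conj_mul hx (hpred hy)).mul_left ‖d‖).add
      ((summable_conj_mul (hpred hx) hy).mul_left ‖b‖)) fun n => ?_
  refine (norm_sub_le _ _).trans_eq ?_
  simp only [norm_mul, RCLike.norm_conj, Complex.norm_natCast]
  ring

/-! ### The adjoint of an operator with tridiagonal matrix -/

/-- The monomial `z ^ n` as an element of `H²`. -/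
noncomputable def monomial (n : ℕ) : Hardy :=
  Hardy.mk (fun z => z ^ n) <| (hasCoeffs_pow n).isHardy <|
    summable_of_ne_finset_zero (s := {n}) fun k hk => by simp_all

theorem hasCoeffs_monomial (n : ℕ) : HasCoeffs (monomial n) (Pi.single n 1) :=
  (hasCoeffs_pow n).congr fun _ hz => (Hardy.mk_apply _ hz).symm

theorem inner_monomial (n : ℕ) {f : Hardy} {x : ℕ → ℂ} (hf : HasCoeffs f x) :
    inner ℂ (monomial n) f = x n := by
  rw [Hardy.inner_eq_tsum_of_hasCoeffs (hasCoeffs_monomial n) hf,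
    tsum_eq_single n fun k hk => by simp [hk]]
  simp

theorem monomial_mem_domain (a b c d : ℂ) (n : ℕ) : monomial n ∈ (quadOp a b c d).domain := by
  refine ((hasCoeffs_monomial n).quad a b c d).isHardy ?_
  refine summable_of_ne_finset_zero (s := Finset.range (n + 2)) fun k hk => ?_
  have hk : n + 2 ≤ k := by simpa using hk
  simp [quadCoeff, show k + 1 ≠ n by omega, show k ≠ n by omega, show k - 1 ≠ n by omega]

theorem dense_domain_quadOp (a b c d : ℂ) : Dense ((quadOp a b c d).domain : Set Hardy) := by
  rw [Submodule.dense_iff_topologicalClosure_eq_top, Submodule.topologicalClosure_eq_top_iff,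
    Submodule.eq_bot_iff]
  intro f hf
  have h : taylorCoeff f = fun _ => 0 := funext fun n => by
    rw [← inner_monomial n f.hasCoeffs]
    exact hf _ (monomial_mem_domain a b c d n)
  refine Hardy.ext fun z hz => (f.hasCoeffs z hz).unique ?_
  simp [h]

/-- The adjoint has the conjugate transposed matrix, with its maximal domain. -/
theorem adjoint_quadOp (a b c d : ℂ) :
    (quadOp a b c d).adjoint = quadOp (conj a) (conj d) (conj c) (conj b) := by
  have hd := dense_domain_quadOp a b c d
  have hS : quadOp (conj a) (conj d) (conj c) (conj b) ≤ (quadOp a b c d).adjoint := by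
    refine LinearPMap.IsFormalAdjoint.le_adjoint hd fun f g => ?_
    rw [Hardy.inner_eq_tsum_of_hasCoeffs (hasCoeffs_quadOp f) (g : Hardy).hasCoeffs,
      Hardy.inner_eq_tsum_of_hasCoeffs (f : Hardy).hasCoeffs (hasCoeffs_quadOp g)]
    have hf := hasCoeffs_quadOp f
    have hg := hasCoeffs_quadOp g
    exact tsum_quadCoeff (f : Hardy).summable_sq (g : Hardy).summable_sq
      (summable_conj_mul ((quadOp a b c d f).isHardy.summable_sq hf) (g : Hardy).summable_sq).of_norm
      (summable_conj_mul (f : Hardy).summable_sq ((quadOp _ _ _ _ g).isHardy.summable_sq hg)).of_norm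
  refine (LinearPMap.eq_of_le_of_domain_eq hS (le_antisymm hS.1 fun g hg => ?_)).symm
  set w := (quadOp a b c d).adjoint ⟨g, hg⟩ with hw
  -- Pairing with the monomials identifies the coefficients of the adjoint applied to `g`.
  have hcoef : taylorCoeff w = quadCoeff (conj a) (conj d) (conj c) (conj b) (taylorCoeff g) := by
    funext n
    have h1 := LinearPMap.adjoint_isFormalAdjoint hd ⟨g, hg⟩
      ⟨monomial n, monomial_mem_domain a b c d n⟩
    have h2 := congrArg conj h1
    have h3 : HasCoeffs (quadOp a b c d ⟨monomial n, monomial_mem_domain a b c d n⟩)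
        (quadCoeff a b c d (Pi.single n 1)) :=
      ((hasCoeffs_monomial n).quad a b c d).congr fun _ hz =>
        (maximalOp_apply ⟨monomial n, monomial_mem_domain a b c d n⟩ hz).symm
    rw [inner_conj_symm, inner_conj_symm, inner_monomial n w.hasCoeffs,
      Hardy.inner_eq_tsum_of_hasCoeffs h3 g.hasCoeffs] at h2
    rw [h2, tsum_quadCoeff ((monomial n).isHardy.summable_sq (hasCoeffs_monomial n)) g.summable_sq
      (summable_conj_mul (Hardy.isHardy _ |>.summable_sq h3) g.summable_sq).of_norm
      (summable_of_ne_finset_zero (s := {n}) fun k hk => by simp_all),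
      tsum_eq_single n fun k hk => by simp [hk]]
    simp
  refine IsHardy.congr w.isHardy fun z hz => ?_
  have hz : ‖z‖ < 1 := by simpa using hz
  exact (hcoef ▸ w.hasCoeffs).eq (g.hasCoeffs.quad _ _ _ _) hz

/-! ### The conjugation -/

theorem hasDerivAt_kappa {μ z : ℂ} (hμ : ‖μ‖ < 1) (hz : ‖z‖ < 1) :
    HasDerivAt (kappa μ) (kappa μ z * (conj μ / (1 - z * conj μ))) z := by
  have h0 := one_sub_ne_zero hμ hz
  have h := (hasDerivAt_const z ((√(1 - ‖μ‖ ^ 2) : ℝ) : ℂ)).div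
    (((hasDerivAt_id z).mul_const (conj μ)).const_sub 1) h0
  refine HasDerivAt.congr_deriv h ?_
  simp only [kappa, id]
  field_simp
  ring

theorem hasDerivAt_phi {μ z : ℂ} (hμ : ‖μ‖ < 1) (hz : ‖z‖ < 1) :
    HasDerivAt (phi μ) (conj μ / μ * ((μ * conj μ - 1) / (1 - z * conj μ) ^ 2)) z := by
  have h0 := one_sub_ne_zero hμ hz
  have h := ((((hasDerivAt_id z).const_sub μ).div
    (((hasDerivAt_id z).mul_const (conj μ)).const_sub 1) h0).const_mul (conj μ / μ))
  refine HasDerivAt.congr_deriv h ?_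
  simp only [id]
  ring

theorem hasDerivAt_jFun {f : ℂ → ℂ} (hf : DifferentiableOn ℂ f (ball 0 1)) (β : ℂ) {μ z : ℂ}
    (hμ : ‖μ‖ < 1) (hz : ‖z‖ < 1) :
    HasDerivAt (JFun β μ f) (β * kappa μ z * (conj μ / (1 - z * conj μ) * conj (f (conj (phi μ z)))
      + conj μ / μ * ((μ * conj μ - 1) / (1 - z * conj μ) ^ 2)
        * conj (deriv f (conj (phi μ z))))) z := by
  have h1 : HasDerivAt f (deriv f (conj (phi μ z))) (conj (phi μ z)) :=
    (hf.differentiableAt (isOpen_ball.mem_nhds (by simpa using norm_phi_lt hμ hz))).hasDerivAt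
  have h2 := h1.conj_conj
  rw [Complex.conj_conj] at h2
  have h3 := ((hasDerivAt_kappa hμ hz).const_mul β).mul (h2.comp z (hasDerivAt_phi hμ hz))
  refine HasDerivAt.congr_deriv h3 ?_
  simp only [Function.comp]
  ring

theorem one_sub_norm_sq_pos {μ : ℂ} (hμ : ‖μ‖ < 1) : 0 < 1 - ‖μ‖ ^ 2 := by
  nlinarith [norm_nonneg μ]

theorem one_sub_mul_conj_ne_zero {μ : ℂ} (hμ : ‖μ‖ < 1) : 1 - μ * conj μ ≠ 0 :=
  one_sub_ne_zero hμ hμ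

theorem kappa_ne_zero {μ z : ℂ} (hμ : ‖μ‖ < 1) (hz : ‖z‖ < 1) : kappa μ z ≠ 0 :=
  div_ne_zero (by exact_mod_cast (Real.sqrt_pos.mpr (one_sub_norm_sq_pos hμ)).ne')
    (one_sub_ne_zero hμ hz)

/-- The denominator of `phi μ` at `conj (phi μ z)`, up to conjugation. -/
theorem one_sub_phi_mul {μ z : ℂ} (hμ0 : μ ≠ 0) (hμ : ‖μ‖ < 1) (hz : ‖z‖ < 1) :
    1 - phi μ z * μ = (1 - μ * conj μ) / (1 - z * conj μ) := by
  have h0' := one_sub_conj_mul_ne_zero hμ hz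
  rw [phi]
  field_simp
  ring

theorem conj_phi_conj_phi {μ z : ℂ} (hμ0 : μ ≠ 0) (hμ : ‖μ‖ < 1) (hz : ‖z‖ < 1) :
    conj (phi μ (conj (phi μ z))) = z := by
  have h0' := one_sub_conj_mul_ne_zero hμ hz
  have h1 : conj μ ≠ 0 := (map_ne_zero _).mpr hμ0
  have h2 := one_sub_phi_mul hμ0 hμ hz
  have h3 := one_sub_mul_conj_ne_zero hμ
  rw [phi]
  simp only [map_mul, map_div₀, map_sub, map_one, Complex.conj_conj]
  rw [h2, phi]
  field_simp
  ring

/-- The anti-linear weighted composition transform is an involution. -/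
theorem jFun_jFun {β μ : ℂ} (hβ : ‖β‖ = 1) (hμ0 : μ ≠ 0) (hμ : ‖μ‖ < 1) (f : ℂ → ℂ) {z : ℂ}
    (hz : ‖z‖ < 1) : JFun β μ (JFun β μ f) z = f z := by
  have h0 := one_sub_ne_zero hμ hz
  have h1 := one_sub_phi_mul hμ0 hμ hz
  have h2' := one_sub_conj_mul_ne_zero hμ hμ
  have h3 : β * conj β = 1 := by rw [Complex.mul_conj']; simp [hβ]
  have h4 : ((√(1 - ‖μ‖ ^ 2) : ℝ) : ℂ) ^ 2 = 1 - μ * conj μ := by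
    rw [← Complex.ofReal_pow, Real.sq_sqrt (one_sub_norm_sq_pos hμ).le, Complex.mul_conj']
    push_cast
    ring
  simp only [JFun, map_mul, Complex.conj_conj]
  rw [conj_phi_conj_phi hμ0 hμ hz]
  have h5 : kappa μ z * conj (kappa μ (conj (phi μ z))) = 1 := by
    simp only [kappa, map_div₀, map_sub, map_one, map_mul, Complex.conj_conj, Complex.conj_ofReal]
    rw [h1]
    field_simp
    rw [h4, mul_comm]
  linear_combination (f z * kappa μ z * conj (kappa μ (conj (phi μ z)))) * h3 + f z * h5

theorem J_apply (β : ℂ) {μ : ℂ} (hμ : ‖μ‖ < 1) (f : Hardy) {z : ℂ} (hz : ‖z‖ < 1) :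
    J β μ hμ f z = JFun β μ f z := Hardy.mk_apply (f.isHardy.jFun β hμ) hz

theorem deriv_J (β : ℂ) {μ : ℂ} (hμ : ‖μ‖ < 1) (f : Hardy) {z : ℂ} (hz : ‖z‖ < 1) :
    deriv (J β μ hμ f) z = deriv (JFun β μ f) z := by
  refine Filter.EventuallyEq.deriv_eq ?_
  filter_upwards [isOpen_ball.mem_nhds (show z ∈ ball (0 : ℂ) 1 by simpa using hz)] with w hw
  exact J_apply β hμ f (by simpa using hw)

theorem jFun_congr {β μ z : ℂ} {f g : ℂ → ℂ} (hμ : ‖μ‖ < 1) (h : ∀ w : ℂ, ‖w‖ < 1 → f w = g w)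
    (hz : ‖z‖ < 1) : JFun β μ f z = JFun β μ g z := by
  rw [JFun, JFun, h _ (by simpa using norm_phi_lt hμ hz)]

theorem J_J {β μ : ℂ} (hβ : ‖β‖ = 1) (hμ0 : μ ≠ 0) (hμ : ‖μ‖ < 1) (f : Hardy) :
    J β μ hμ (J β μ hμ f) = f := Hardy.ext fun z hz => by
  rw [J_apply β hμ _ hz, jFun_congr hμ (fun w hw => J_apply β hμ f hw) hz, jFun_jFun hβ hμ0 hμ f hz]

/-- The relation between the coefficients is what makes the conjugation carry the differential
expression of `quadOp a b c d` to the one of its adjoint. -/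
theorem jFun_quad {a b c d μ : ℂ} (hμ0 : μ ≠ 0) (hμ : ‖μ‖ < 1)
    (hd : d = -(μ * b / conj μ) - μ * c) (β : ℂ) {f : ℂ → ℂ}
    (hf : DifferentiableOn ℂ f (ball 0 1)) {z : ℂ} (hz : ‖z‖ < 1) :
    JFun β μ (fun z => (a + b * z) * f z + (d + c * z + b * z ^ 2) * deriv f z) z
      = (conj a + conj d * z) * JFun β μ f z
        + (conj b + conj c * z + conj d * z ^ 2) * deriv (JFun β μ f) z := by
  have h0' := one_sub_conj_mul_ne_zero hμ hz
  have hd' : conj d = -(conj μ * conj b / μ) - conj μ * conj c := by simp [hd]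
  rw [(hasDerivAt_jFun hf β hμ hz).deriv]
  simp only [JFun, map_add, map_mul, map_pow, Complex.conj_conj]
  generalize conj (f (conj (phi μ z))) = F
  generalize conj (deriv f (conj (phi μ z))) = G
  generalize kappa μ z = k
  rw [hd', phi]
  field_simp
  ring

/-- Under the relation between the coefficients, `quadOp` is selfadjoint for the conjugation. -/
theorem quadOp_eq_conjOp {a b c d β μ : ℂ} (hβ : ‖β‖ = 1) (hμ0 : μ ≠ 0) (hμ : ‖μ‖ < 1)
    (hd : d = -(μ * b / conj μ) - μ * c) :
    quadOp a b c d = conjOp (J β μ hμ) (quadOp a b c d).adjoint := by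
  rw [adjoint_quadOp]
  have key : ∀ (f : Hardy) (z : ℂ), ‖z‖ < 1 →
      JFun β μ (fun z => (a + b * z) * f z + (d + c * z + b * z ^ 2) * deriv f z) z
        = (conj a + conj d * z) * J β μ hμ f z
          + (conj b + conj c * z + conj d * z ^ 2) * deriv (J β μ hμ f) z := fun f z hz => by
    rw [jFun_quad hμ0 hμ hd β f.isHardy.1 hz, J_apply β hμ f hz, deriv_J β hμ f hz]
  have key' : ∀ (f : Hardy) (z : ℂ), ‖z‖ < 1 →
      JFun β μ (fun z => (conj a + conj d * z) * J β μ hμ f z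
          + (conj b + conj c * z + conj d * z ^ 2) * deriv (J β μ hμ f) z) z
        = (a + b * z) * f z + (d + c * z + b * z ^ 2) * deriv f z := fun f z hz => by
    rw [← jFun_congr hμ (key f) hz, jFun_jFun hβ hμ0 hμ _ hz]
  refine LinearPMap.ext (Submodule.ext fun f => ⟨fun hf => ?_, fun hf => ?_⟩) fun f hf hg =>
    Hardy.ext fun z hz => ?_
  · exact IsHardy.congr (IsHardy.jFun hf β hμ) fun z hz => key f z (by simpa using hz)
  · exact IsHardy.congr (IsHardy.jFun hf β hμ) fun z hz => key' f z (by simpa using hz)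
  · refine (maximalOp_apply _ hz).trans ((key' f z hz).symm.trans ?_)
    refine Eq.trans ?_ (J_apply β hμ _ hz).symm
    exact jFun_congr hμ (fun w hw => (maximalOp_apply ⟨J β μ hμ f, hg⟩ hw).symm) hz

/-! ### Operators selfadjoint for the conjugation -/

section

variable {β μ : ℂ} {ψ₀ ψ₁ : ℂ → ℂ} {E : Hardy →ₗ.[ℂ] Hardy}

/-- The reproducing kernels lie in the domain of the adjoint of every densely defined differential
operator of first order, and the adjoint acts on them explicitly. -/
theorem exists_adjoint_kernel (hE : E ≤ maximalOp ψ₀ ψ₁) (hdense : Dense (E.domain : Set Hardy))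
    {v : ℂ} (hv : ‖v‖ < 1) : ∃ h : kernel v hv ∈ E.adjoint.domain,
      E.adjoint ⟨kernel v hv, h⟩ = conj (ψ₀ v) • kernel v hv + conj (ψ₁ v) • derivKernel v hv := by
  have key : ∀ f : E.domain,
      inner ℂ (conj (ψ₀ v) • kernel v hv + conj (ψ₁ v) • derivKernel v hv) (f : Hardy)
        = inner ℂ (kernel v hv) (E f) := fun f => by
    rw [inner_add_left, inner_smul_left, inner_smul_left, inner_kernel, inner_kernel,
      inner_derivKernel, Complex.conj_conj, Complex.conj_conj,
      hE.2 (show (f : Hardy) = (⟨f, hE.1 f.2⟩ : (maximalOp ψ₀ ψ₁).domain) from rfl),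
      maximalOp_apply _ hv]
  exact ⟨LinearPMap.mem_adjoint_domain_of_exists _ ⟨_, key⟩,
    LinearPMap.adjoint_apply_eq hdense _ key⟩

/-- The functional equation for the symbols that results from evaluating `E J K = J E* K` at `u`,
for the reproducing kernel `K` at `v`. -/
theorem IsCSelfAdjoint.symbol_eq (hβ : ‖β‖ = 1) (hμ0 : μ ≠ 0) (hμ : ‖μ‖ < 1)
    (hE : E ≤ maximalOp ψ₀ ψ₁) (h : IsCSelfAdjoint (J β μ hμ) E) {u v : ℂ} (hu : ‖u‖ < 1)
    (hv : ‖v‖ < 1) :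
    ψ₀ u * (1 - phi μ u * v) + ψ₁ u * (conj μ / (1 - u * conj μ) * (1 - phi μ u * v)
        + conj μ / μ * ((μ * conj μ - 1) / (1 - u * conj μ) ^ 2) * v)
      = ψ₀ v * (1 - phi μ u * v) + ψ₁ v * phi μ u := by
  obtain ⟨hK, hEK⟩ := exists_adjoint_kernel hE h.1 hv
  set K := kernel v hv with hKdef
  have hp := norm_phi_lt hμ hu
  have hpc : ‖conj (phi μ u)‖ < 1 := by simpa using hp
  have hmem : J β μ hμ K ∈ (conjOp (J β μ hμ) E.adjoint).domain := by
    change J β μ hμ (J β μ hμ K) ∈ E.adjoint.domain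
    rwa [J_J hβ hμ0]
  have hmem' : J β μ hμ K ∈ E.domain := by rw [h.2]; exact hmem
  have h1 : maximalOp ψ₀ ψ₁ ⟨J β μ hμ K, hE.1 hmem'⟩
      = J β μ hμ (E.adjoint ⟨K, hK⟩) := by
    rw [← hE.2 (x := ⟨J β μ hμ K, hmem'⟩) rfl, h.2.le.2 (y := ⟨J β μ hμ K, hmem⟩) rfl]
    change J β μ hμ (E.adjoint ⟨J β μ hμ (J β μ hμ K), _⟩) = _
    congr 2
    exact Subtype.ext (J_J hβ hμ0 hμ K)
  have h2 : maximalOp ψ₀ ψ₁ ⟨J β μ hμ K, hE.1 hmem'⟩ u = J β μ hμ (E.adjoint ⟨K, hK⟩) u := by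
    rw [h1]
  have hderiv : deriv K (conj (phi μ u)) = conj v / (1 - conj v * conj (phi μ u)) ^ 2 := by
    refine HasDerivAt.deriv ((hasDerivAt_kernel hv hpc).congr_of_eventuallyEq ?_)
    filter_upwards [isOpen_ball.mem_nhds
      (show conj (phi μ u) ∈ ball (0 : ℂ) 1 by simpa using hp)] with w hw
    exact kernel_apply hv (by simpa using hw)
  rw [maximalOp_apply _ hu, hEK, J_apply β hμ _ hu, deriv_J β hμ _ hu,
    (hasDerivAt_jFun K.isHardy.1 β hμ hu).deriv, J_apply β hμ _ hu] at h2
  simp only [JFun, Hardy.add_apply, Hardy.smul_apply, hderiv] at h2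
  rw [hKdef, kernel_apply hv hpc, derivKernel_apply hv hpc] at h2
  simp only [map_add, map_mul, map_div₀, map_inv₀, map_sub, map_one, map_pow,
    Complex.conj_conj] at h2
  have hk := kappa_ne_zero hμ hu
  have hβ0 : β ≠ 0 := norm_ne_zero_iff.mp (by simp [hβ])
  have h3 : 1 - phi μ u * v ≠ 0 := by
    simpa [mul_comm] using one_sub_ne_zero (μ := conj v) (z := phi μ u) (by simpa using hv) hp
  rw [mul_comm v (phi μ u)] at h2
  generalize phi μ u = p at *
  refine mul_left_cancel₀ (mul_ne_zero hβ0 hk) ?_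
  field_simp at h2 ⊢
  linear_combination h2

/-- The solutions of the functional equation for the symbols. -/
theorem IsCSelfAdjoint.exists_symbol (hβ : ‖β‖ = 1) (hμ0 : μ ≠ 0) (hμ : ‖μ‖ < 1)
    (hE : E ≤ maximalOp ψ₀ ψ₁) (h : IsCSelfAdjoint (J β μ hμ) E) :
    ∃ a b c d : ℂ, d = -(μ * b / conj μ) - μ * c ∧
      ∀ u ∈ ball (0 : ℂ) 1, ψ₀ u = a + b * u ∧ ψ₁ u = d + c * u + b * u ^ 2 := by
  have hμc : conj μ ≠ 0 := (map_ne_zero _).mpr hμ0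
  have hs := one_sub_mul_conj_ne_zero hμ
  obtain ⟨b, hb⟩ : ∃ b, b = -(ψ₁ μ * (conj μ / μ) / (1 - μ * conj μ)) := ⟨_, rfl⟩
  -- At `v = μ` the unknown `ψ₁ u` drops out of the functional equation, so `ψ₀` is affine.
  have h₀ : ∀ u : ℂ, ‖u‖ < 1 → ψ₀ u = ψ₀ μ - b * μ + b * u := fun u hu => by
    have h1 := h.symbol_eq hβ hμ0 hμ hE hu hμ
    have h0 := one_sub_ne_zero hμ hu
    have h0' := one_sub_conj_mul_ne_zero hμ hu
    rw [one_sub_phi_mul hμ0 hμ hu, phi] at h1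
    rw [hb]
    field_simp at h1 ⊢
    refine mul_left_cancel₀ h0 ?_
    linear_combination h1
  -- At `v = 0` the equation expresses `ψ₁ u` through `ψ₀ u` and constants.
  have h₁ : ∀ u : ℂ, ‖u‖ < 1 →
      ψ₁ u = ψ₁ 0 + (-(b / conj μ) - ψ₁ 0 / μ) * u + b * u ^ 2 := fun u hu => by
    have h1 := h.symbol_eq hβ hμ0 hμ hE hu (v := 0) (by simp)
    have h0 := one_sub_ne_zero hμ hu
    rw [h₀ u hu, h₀ 0 (by simp), phi] at h1
    field_simp at h1 ⊢
    refine mul_left_cancel₀ h0 ?_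
    linear_combination h1
  refine ⟨ψ₀ μ - b * μ, b, -(b / conj μ) - ψ₁ 0 / μ, ψ₁ 0, ?_, fun u hu => ?_⟩
  · field_simp
    ring
  · have hu : ‖u‖ < 1 := by simpa using hu
    exact ⟨h₀ u hu, h₁ u hu⟩

theorem adjoint_domain_anti {S T : Hardy →ₗ.[ℂ] Hardy} (hST : S ≤ T) :
    T.adjoint.domain ≤ S.adjoint.domain := fun g hg => by
  have h1 : Continuous ((innerₛₗ ℂ g).comp T.toFun) := hg
  have h2 : Continuous (Submodule.inclusion hST.1) := continuous_inclusion hST.1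
  refine (h1.comp h2).congr fun x => ?_
  exact congrArg (inner ℂ g) (hST.2 (x := x) (y := Submodule.inclusion hST.1 x) rfl).symm

end

end HardyDiff

theorem mainTheorem6 (β μ : ℂ) (hβ : ‖β‖ = 1) (hμ : ‖μ‖ < 1) (hμ0 : μ ≠ 0)
    (ψ₀ ψ₁ : ℂ → ℂ) (hψ₀ : DifferentiableOn ℂ ψ₀ (Metric.ball 0 1))
    (hψ₁ : DifferentiableOn ℂ ψ₁ (Metric.ball 0 1))
    (E : HardyDiff.Hardy →ₗ.[ℂ] HardyDiff.Hardy) (hE : E ≤ HardyDiff.maximalOp ψ₀ ψ₁) :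
    HardyDiff.IsCSelfAdjoint (HardyDiff.J β μ hμ) E ↔
      E = HardyDiff.maximalOp ψ₀ ψ₁ ∧
        ∃ a b c d : ℂ, d = -(μ * b / starRingEnd ℂ μ) - μ * c ∧
          ∀ u ∈ Metric.ball (0 : ℂ) 1, ψ₀ u = a + b * u ∧ ψ₁ u = d + c * u + b * u ^ 2 := by
  have hquad : ∀ a b c d : ℂ,
      (∀ u ∈ Metric.ball (0 : ℂ) 1, ψ₀ u = a + b * u ∧ ψ₁ u = d + c * u + b * u ^ 2) →
        HardyDiff.maximalOp ψ₀ ψ₁ = HardyDiff.quadOp a b c d := fun a b c d h =>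
    HardyDiff.maximalOp_congr (fun u hu => (h u hu).1) fun u hu => (h u hu).2
  constructor
  · intro h
    obtain ⟨a, b, c, d, hd, hψ⟩ := h.exists_symbol hβ hμ0 hμ hE
    refine ⟨LinearPMap.eq_of_le_of_domain_eq hE (le_antisymm hE.1 ?_), a, b, c, d, hd, hψ⟩
    have hT := HardyDiff.quadOp_eq_conjOp (a := a) hβ hμ0 hμ hd
    rw [← hquad a b c d hψ] at hT
    -- `E ≤ T` and `T = J T* J` give `T = J T* J ≤ J E* J = E` on the level of domains.
    refine hT.le.1.trans (le_trans ?_ h.2.ge.1)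
    exact Submodule.comap_mono (HardyDiff.adjoint_domain_anti hE)
  · rintro ⟨rfl, a, b, c, d, hd, hψ⟩
    rw [hquad a b c d hψ]
    exact ⟨HardyDiff.dense_domain_quadOp a b c d, HardyDiff.quadOp_eq_conjOp hβ hμ0 hμ hd⟩
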